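/- Let $d\ge 2$, $\rho\in[0,1)$ and let $Q=(q_{ij})$ be a real orthogonal $d\times d$ matrix. Let $(U_1,V_1),(U_2,V_2),\dots$ be independent random pairs of unit vectors in $\mathbb{R}^d$, each having on $S^{d-1}\times S^{d-1}$ the density $$c(u,v)=\frac{1}{A_{d-1}^2}\,\frac{1-\rho^2}{(1-2\rho\,u'Qv+\rho^2)^{d/2}},\qquad A_{d-1}=\frac{2\pi^{d/2}}{\Gamma(d/2)},$$ with respect to the product of the surface measures. For $n\ge 1$ let $$\widehat{\rho Q}_n=\frac{d}{n}\sum_{j=1}^n U_jV_j'$$ be the moment estimator of $\rho Q$ (written $\hat\rho\hat Q$). Then: (i) $\widehat{\rho Q}_n$ is an unbiased and consistent estimator of $\rho Q$: $E(\widehat{\rho Q}_n)=\rho Q$ for every $n\ge 1$, and $\widehat{\rho Q}_n\to\rho Q$ in probability as $n\to\infty$. (ii) For a $d\times d$ matrix $A=(a_1,\dots,a_d)$ with columns $a_1,\dots,a_d$, let $g(A)=(a_1',\dots,a_d')'\in\mathbb{R}^{d^2}$. Then $$\sqrt n\,\{g(\widehat{\rho Q}_n)-g(\rho Q)\}\xrightarrow{d}N(0,\Sigma)\qquad(n\to\infty),$$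 where $\Sigma=(\sigma_{rs})_{1\le r,s\le d^2}$ is the positive semidefinite matrix whose entries, for $r=d(j-1)+i$ and $s=d(l-1)+k$ with $1\le i,j,k,l\le d$, are $$\sigma_{rs}=\begin{cases}1+\dfrac{\rho^2}{d+2}\{(d-2)q_{ij}^2-2\}, & r=s,\\[2mm] \dfrac{\rho^2}{d+2}\,(d\,q_{kj}q_{il}-2q_{ij}q_{kl}), & r\ne s.\end{cases}$$ -/

import Mathlib

open MeasureTheory ProbabilityTheory Filter
open scoped Matrix Topology ENNReal

noncomputable section

/-- The unit sphere `S^{d-1}` of `ℝ^d` with the Euclidean norm. -/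
abbrev UnitSphere (d : ℕ) : Type :=
  Metric.sphere (0 : EuclideanSpace ℝ (Fin d)) 1

/-- The coordinates of a unit vector, as a column vector. -/
def coords {d : ℕ} (u : UnitSphere d) : Fin d → ℝ := u.1.ofLp

/-- The surface measure on `S^{d-1}`. -/
def surfaceMeasure (d : ℕ) : Measure (UnitSphere d) :=
  (volume : Measure (EuclideanSpace ℝ (Fin d))).toSphere

/-- The surface area `A_{d-1} = 2 π^{d/2} / Γ(d/2)` of `S^{d-1}`. -/
def surfaceArea (d : ℕ) : ℝ :=
  2 * Real.pi ^ ((d : ℝ) / 2) / Real.Gamma ((d : ℝ) / 2)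

/-- The density `c(u, v) = A_{d-1}⁻² (1 - ρ²) / (1 - 2 ρ u'Qv + ρ²)^{d/2}`. -/
def bsDensity {d : ℕ} (ρ : ℝ) (Q : Matrix (Fin d) (Fin d) ℝ) (u v : UnitSphere d) : ℝ :=
  1 / surfaceArea d ^ 2 *
    ((1 - ρ ^ 2) / (1 - 2 * ρ * (coords u ⬝ᵥ (Q *ᵥ coords v)) + ρ ^ 2) ^ ((d : ℝ) / 2))

/-- The distribution `BS_d(ρQ)` on `S^{d-1} × S^{d-1}`: the measure with density `bsDensity ρ Q`
with respect to the product of the surface measures. -/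
def bsMeasure {d : ℕ} (ρ : ℝ) (Q : Matrix (Fin d) (Fin d) ℝ) :
    Measure (UnitSphere d × UnitSphere d) :=
  ((surfaceMeasure d).prod (surfaceMeasure d)).withDensity
    fun p => ENNReal.ofReal (bsDensity ρ Q p.1 p.2)

/-- The moment estimator `(d / n) ∑ U_j V_j'` of `ρQ` computed from the pairs with indices
`0, …, n - 1`. -/
def momentEstimator {d : ℕ} {Ω : Type*} (U V : ℕ → Ω → UnitSphere d) (n : ℕ) (ω : Ω) :
    Matrix (Fin d) (Fin d) ℝ :=
  ((d : ℝ) / (n : ℝ)) •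
    ∑ j ∈ Finset.range n, Matrix.vecMulVec (coords (U j ω)) (coords (V j ω))

/-- The columns of `A` stacked into one vector of `ℝ^{d²}`. With indices counted from `0`, the
entry `(i, j)` of `A` is placed at the position `d * j + i`. -/
def stackColumns {d : ℕ} (A : Matrix (Fin d) (Fin d) ℝ) : EuclideanSpace ℝ (Fin (d * d)) :=
  WithLp.toLp 2 fun m => A (finProdFinEquiv.symm m).2 (finProdFinEquiv.symm m).1

/-- The `d² × d²` covariance matrix. The row `m` corresponds to the entry `(i, j)` and the
column `n` to the entry `(k, l)` of a `d × d` matrix, in the order of `stackColumns`. -/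
def asymptoticCov {d : ℕ} (ρ : ℝ) (Q : Matrix (Fin d) (Fin d) ℝ) :
    Matrix (Fin (d * d)) (Fin (d * d)) ℝ :=
  Matrix.of fun m n =>
    let i := (finProdFinEquiv.symm m).2
    let j := (finProdFinEquiv.symm m).1
    let k := (finProdFinEquiv.symm n).2
    let l := (finProdFinEquiv.symm n).1
    if m = n then
      1 + ρ ^ 2 / ((d : ℝ) + 2) * (((d : ℝ) - 2) * Q i j ^ 2 - 2)
    else
      ρ ^ 2 / ((d : ℝ) + 2) * ((d : ℝ) * Q k j * Q i l - 2 * Q i j * Q k l)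

end

open scoped InnerProductSpace

/-! Given `v`, the density in `u` is a multiple of the Poisson kernel with pole `w = Qv`, a unit
vector because `Q` is orthogonal. Its mean is `ρ w` and its second moment matrix is `ρ² w w' + (1 -
ρ²)/d · I`. Since `v` is uniform, the moments of the entries of `u v'` up to order two reduce to
second and fourth moments of the uniform law. Hence the vectors `d · vec(U_j V_j')` are iid and
bounded, with mean `vec(ρQ)` and covariance `Σ`. The strong law gives consistency, and the central
limit theorem, through one-dimensional projections, gives the limit law. `Σ` is positive
semidefinite because its quadratic form is a variance.

The Poisson moments are obtained without harmonic analysis. Invariance under rotations yields a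
Stein identity (`integral_zonal_eq_add`). Put `D = 1 - 2rt + r²` with `t = ⟪w, u⟫`, and let `M_k(r)`
be the integral of `D^(-k)`. Stein's identity relates `M_(k-1)`, `M_k`, `M_(k+1)`, and
differentiation in `r` relates `M_k'` to `M_k`, `M_(k+1)`. Together they form a closed linear system
for `(1 - r²) M_(d/2)` and `M_(d/2-1)`, whose solution is constant (`zonalIntegral_closed_forms`).
As `t = (1 + r² - D)/(2r)`, the moments of `t` are combinations of the `M_k`. -/

/-! ### Invariance of the surface measure and Stein's identity -/

open Set Metric in
/-- The surface measure is invariant under linear isometries. -/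
theorem integral_sphere_comp {d : ℕ}
    (e : EuclideanSpace ℝ (Fin d) ≃ₗᵢ[ℝ] EuclideanSpace ℝ (Fin d))
    (f : EuclideanSpace ℝ (Fin d) → ℝ) :
    ∫ u : UnitSphere d, f (e u) ∂surfaceMeasure d = ∫ u : UnitSphere d, f u ∂surfaceMeasure d := by
  let T : UnitSphere d ≃ₜ UnitSphere d := e.toHomeomorph.subtype fun x => by simp
  have hT : MeasurePreserving T (surfaceMeasure d) (surfaceMeasure d) := by
    refine ⟨T.continuous.measurable, Measure.ext fun s hs => ?_⟩
    rw [Measure.map_apply T.continuous.measurable hs, surfaceMeasure,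
      Measure.toSphere_apply' _ hs, Measure.toSphere_apply' _ (T.continuous.measurable hs)]
    congr 1
    -- The surface measure of `s` is, up to the dimension factor, the volume of the cone over `s`;
    -- the cone over a preimage is the preimage of the cone.
    refine Eq.trans (congrArg volume ?_)
      (e.measurePreserving.measure_preimage_equiv (f := e.toMeasurableEquiv) _)
    ext x
    simp only [Set.mem_smul, mem_preimage]
    constructor
    · rintro ⟨r, hr, y, ⟨z, hz, rfl⟩, rfl⟩
      exact ⟨r, hr, _, ⟨T z, hz, rfl⟩, by simp [T]⟩
    · rintro ⟨r, hr, y, ⟨z, hz, rfl⟩, hx⟩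
      refine ⟨r, hr, _, ⟨T.symm z, by simpa using hz, rfl⟩, ?_⟩
      apply e.injective
      have : e (T.symm z) = z := congrArg Subtype.val (T.apply_symm_apply z)
      simpa [this] using hx
  exact hT.integral_comp T.measurableEmbedding (fun u : UnitSphere d => f u)

/-- Differentiation under the integral sign over a compact space. -/
theorem hasDerivAt_integral_of_compactSpace {S : Type*} [TopologicalSpace S] [CompactSpace S]
    [MeasurableSpace S] [BorelSpace S] (μ : Measure S) [IsFiniteMeasure μ]
    {f f' : ℝ → S → ℝ} {x₀ ε : ℝ} (hε : 0 < ε)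
    (hf : ∀ x ∈ Metric.ball x₀ ε, Continuous (f x))
    (hd : ∀ x ∈ Metric.ball x₀ ε, ∀ s, HasDerivAt (fun y => f y s) (f' x s) x)
    (hf' : ContinuousOn (fun p : ℝ × S => f' p.1 p.2) (Metric.ball x₀ ε ×ˢ Set.univ)) :
    HasDerivAt (fun x => ∫ s, f x s ∂μ) (∫ s, f' x₀ s ∂μ) x₀ := by
  -- Halving the radius makes the parameter set compact, so the derivative has a constant dominating
  -- bound.
  have hsub : Metric.closedBall x₀ (ε / 2) ⊆ Metric.ball x₀ ε :=
    Metric.closedBall_subset_ball (by linarith)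
  obtain ⟨C, hC⟩ := ((isCompact_closedBall x₀ (ε / 2)).prod
    (isCompact_univ (X := S))).exists_bound_of_continuousOn
      (hf'.mono (Set.prod_mono hsub le_rfl))
  have hx₀ : x₀ ∈ Metric.ball x₀ ε := Metric.mem_ball_self hε
  have hc : Continuous (f' x₀) := by
    rw [← continuousOn_univ]
    exact hf'.comp (by fun_prop : ContinuousOn (fun s : S => (x₀, s)) Set.univ)
      fun s _ => ⟨hx₀, trivial⟩
  have hint : ∀ g : S → ℝ, Continuous g → Integrable g μ := fun g hg =>
    hg.integrable_of_hasCompactSupport (HasCompactSupport.of_compactSpace g)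
  refine (hasDerivAt_integral_of_dominated_loc_of_deriv_le (bound := fun _ => C)
    (Metric.closedBall_mem_nhds x₀ (half_pos hε)) ?_ (hint _ (hf _ hx₀))
    (hint _ hc).aestronglyMeasurable ?_ (integrable_const C) ?_).2
  · filter_upwards [Metric.ball_mem_nhds x₀ hε] with x hx
    exact (hint _ (hf x hx)).aestronglyMeasurable
  · exact ae_of_all _ fun s x hx => hC (x, s) ⟨hx, trivial⟩
  · exact ae_of_all _ fun s x hx => hd x (hsub hx) s

instance {d : ℕ} : IsFiniteMeasure (surfaceMeasure d) := by
  unfold surfaceMeasure; infer_instance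

theorem integrable_sphere {d : ℕ} {g : UnitSphere d → ℝ} (hg : Continuous g) :
    Integrable g (surfaceMeasure d) :=
  hg.integrable_of_hasCompactSupport (HasCompactSupport.of_compactSpace g)

theorem inner_mem_Icc {d : ℕ} {w : EuclideanSpace ℝ (Fin d)} (hw : ‖w‖ = 1) (u : UnitSphere d) :
    ⟪w, u⟫_ℝ ∈ Set.Icc (-1 : ℝ) 1 := by
  have := abs_real_inner_le_norm w u
  rw [hw, norm_eq_of_mem_sphere u, mul_one, abs_le] at this
  exact this

theorem continuous_zonal {d : ℕ} {w : EuclideanSpace ℝ (Fin d)} (hw : ‖w‖ = 1) {f : ℝ → ℝ}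
    (hf : ContinuousOn f (Set.Icc (-1) 1)) :
    Continuous fun u : UnitSphere d => f ⟪w, u⟫_ℝ :=
  hf.comp_continuous (by fun_prop) (inner_mem_Icc hw)

open NormedSpace in
/-- The divergence theorem on the sphere for the field of an infinitesimal rotation. -/
theorem integral_rotation_deriv {d : ℕ} (w b : EuclideanSpace ℝ (Fin d))
    (g : EuclideanSpace ℝ (Fin d) → ℝ)
    (G : EuclideanSpace ℝ (Fin d) → EuclideanSpace ℝ (Fin d) →L[ℝ] ℝ)
    (hg : ∀ u : UnitSphere d, HasFDerivAt g (G u) u)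
    (hG : Continuous fun u : UnitSphere d => G u) :
    ∫ u : UnitSphere d, G u (⟪b, u⟫_ℝ • w - ⟪w, u⟫_ℝ • b) ∂surfaceMeasure d = 0 := by
  let E := EuclideanSpace ℝ (Fin d)
  -- `K` is skew-adjoint, so `exp (θ • K)` is orthogonal and the integral of `g ∘ exp (θ • K)` does
  -- not depend on `θ`; its derivative at `0` is the claim.
  let K : E →L[ℝ] E := (innerSL ℝ b).smulRight w - (innerSL ℝ w).smulRight b
  have hK : ∀ x, K x = ⟪b, x⟫_ℝ • w - ⟪w, x⟫_ℝ • b := fun x => by simp [K]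
  have hKs : K ∈ skewAdjoint (E →L[ℝ] E) := by
    rw [skewAdjoint.mem_iff, ContinuousLinearMap.star_eq_adjoint]
    symm
    rw [ContinuousLinearMap.eq_adjoint_iff]
    intro x y
    simp only [neg_apply, hK, inner_neg_left, inner_sub_left, inner_sub_right,
      inner_smul_left, inner_smul_right, RCLike.conj_to_real]
    rw [real_inner_comm w x, real_inner_comm b x]
    ring
  let _ : NormedAlgebra ℚ (E →L[ℝ] E) := NormedAlgebra.restrictScalars ℚ ℝ _
  have hU : ∀ θ : ℝ, exp (θ • K) ∈ unitary (E →L[ℝ] E) := fun θ =>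
    exp_mem_unitary_of_mem_skewAdjoint (skewAdjoint.smul_mem θ hKs)
  have hn : ∀ (θ : ℝ) (u : UnitSphere d), ‖exp (θ • K) (u : E)‖ = 1 := fun θ u => by
    exact ((Unitary.linearIsometryEquiv ⟨_, hU θ⟩ : E ≃ₗᵢ[ℝ] E).norm_map u).trans
      (norm_eq_of_mem_sphere u)
  have hexp : Continuous fun θ : ℝ => exp (θ • K) :=
    continuous_iff_continuousAt.2 fun θ => (hasDerivAt_exp_smul_const' K θ).continuousAt
  have hcm : Continuous fun p : ℝ × UnitSphere d => exp (p.1 • K) (p.2 : E) :=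
    (hexp.comp continuous_fst).clm_apply (by fun_prop)
  have hcs : Continuous fun p : ℝ × UnitSphere d =>
      (⟨exp (p.1 • K) (p.2 : E), by simpa using hn p.1 p.2⟩ : UnitSphere d) :=
    hcm.subtype_mk _
  have hder : ∀ (θ : ℝ) (u : UnitSphere d), HasDerivAt (fun θ => g (exp (θ • K) (u : E)))
      (G (exp (θ • K) (u : E)) (K (exp (θ • K) (u : E)))) θ := fun θ u => by
    have h1 : HasDerivAt (fun θ : ℝ => exp (θ • K) (u : E)) (K (exp (θ • K) (u : E))) θ := by
      have := (hasDerivAt_exp_smul_const' K θ).clm_apply (hasDerivAt_const θ (u : E))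
      simpa using this
    exact (hg ⟨exp (θ • K) (u : E), by simpa using hn θ u⟩).comp_hasDerivAt θ h1
  have hgc : Continuous fun u : UnitSphere d => g u := continuous_iff_continuousAt.2 fun u =>
    (hg u).continuousAt.comp continuous_subtype_val.continuousAt
  have key := hasDerivAt_integral_of_compactSpace (surfaceMeasure d)
    (f := fun θ u => g (exp (θ • K) (u : E)))
    (f' := fun θ u => G (exp (θ • K) (u : E)) (K (exp (θ • K) (u : E)))) (x₀ := 0) one_pos
    (fun θ _ => hgc.comp (hcs.comp (by fun_prop : Continuous fun u : UnitSphere d => (θ, u))))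
    (fun θ _ u => hder θ u)
    (((hG.comp hcs).clm_apply (K.continuous.comp hcm)).continuousOn)
  have hconst : (fun θ : ℝ => ∫ u : UnitSphere d, g (exp (θ • K) (u : E)) ∂surfaceMeasure d) =
      fun _ => ∫ u : UnitSphere d, g u ∂surfaceMeasure d := by
    funext θ
    exact integral_sphere_comp (Unitary.linearIsometryEquiv ⟨_, hU θ⟩ : E ≃ₗᵢ[ℝ] E) g
  rw [hconst] at key
  have h0 : exp ((0 : ℝ) • K) = 1 := by
    have hz : (0 : ℝ) • K = 0 := zero_smul ℝ K
    rw [hz, exp_zero]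
  have := key.unique (hasDerivAt_const _ _)
  simpa only [h0, one_apply_eq_self, hK] using this

/-- First moments of a zonal weight on the sphere. -/
theorem integral_inner_mul_zonal {d : ℕ} {w : EuclideanSpace ℝ (Fin d)} (hw : ‖w‖ = 1)
    (b : EuclideanSpace ℝ (Fin d)) {f : ℝ → ℝ} (hf : ContinuousOn f (Set.Icc (-1) 1)) :
    ∫ u : UnitSphere d, ⟪b, u⟫_ℝ * f ⟪w, u⟫_ℝ ∂surfaceMeasure d =
      ⟪w, b⟫_ℝ * ∫ u : UnitSphere d, ⟪w, u⟫_ℝ * f ⟪w, u⟫_ℝ ∂surfaceMeasure d := by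
  -- This reflection fixes `w` and negates its orthogonal complement, so only the component of `b`
  -- along `w` survives.
  have h := integral_sphere_comp (ℝ ∙ w).reflection fun x => ⟪b, x⟫_ℝ * f ⟪w, x⟫_ℝ
  have hR : ∀ x, (ℝ ∙ w).reflection x = (2 * ⟪w, x⟫_ℝ) • w - x := fun x => by
    rw [Submodule.reflection_singleton_apply]
    simp [hw, two_smul, two_mul, add_smul]
  have hww : ⟪w, w⟫_ℝ = 1 := by simp [hw]
  have h1 : ∀ u : UnitSphere d, ⟪b, (ℝ ∙ w).reflection u⟫_ℝ * f ⟪w, (ℝ ∙ w).reflection u⟫_ℝ =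
      2 * ⟪w, b⟫_ℝ * (⟪w, u⟫_ℝ * f ⟪w, u⟫_ℝ) - ⟪b, u⟫_ℝ * f ⟪w, u⟫_ℝ := fun u => by
    simp only [hR, inner_sub_right, inner_smul_right, hww]
    rw [real_inner_comm b w]
    ring_nf
  have hz := continuous_zonal hw hf
  simp only [h1] at h
  have h2 : Integrable (fun u : UnitSphere d => ⟪w, u⟫_ℝ * f ⟪w, u⟫_ℝ) (surfaceMeasure d) :=
    integrable_sphere (Continuous.mul (by fun_prop) hz)
  have h3 : Integrable (fun u : UnitSphere d => ⟪b, u⟫_ℝ * f ⟪w, u⟫_ℝ) (surfaceMeasure d) :=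
    integrable_sphere (Continuous.mul (by fun_prop) hz)
  rw [integral_sub (h2.const_mul _) h3, integral_const_mul] at h
  linarith

/-- Integration by parts: the rotation field in the plane of `w` and `b` is applied to `⟪a, x⟫ F(⟪w,
x⟫)`, and the resulting first moments collapse onto `w` by reflection. -/
theorem integral_inner_mul_inner_mul_zonal_antideriv {d : ℕ} {w : EuclideanSpace ℝ (Fin d)}
    (hw : ‖w‖ = 1) (a b : EuclideanSpace ℝ (Fin d)) {F f : ℝ → ℝ}
    (hF : ∀ t ∈ Set.Icc (-1 : ℝ) 1, HasDerivAt F (f t) t)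
    (hf : ContinuousOn f (Set.Icc (-1) 1)) :
    ∫ u : UnitSphere d, ⟪a, u⟫_ℝ * ⟪b, u⟫_ℝ * f ⟪w, u⟫_ℝ ∂surfaceMeasure d =
      ⟪w, a⟫_ℝ * ⟪w, b⟫_ℝ * ∫ u : UnitSphere d, ⟪w, u⟫_ℝ ^ 2 * f ⟪w, u⟫_ℝ ∂surfaceMeasure d +
      (⟪a, b⟫_ℝ - ⟪w, a⟫_ℝ * ⟪w, b⟫_ℝ) *
        ∫ u : UnitSphere d, ⟪w, u⟫_ℝ * F ⟪w, u⟫_ℝ ∂surfaceMeasure d := by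
  have hFc : ContinuousOn F (Set.Icc (-1) 1) := fun t ht => (hF t ht).continuousAt.continuousWithinAt
  have hfz := continuous_zonal hw hf
  have hFz := continuous_zonal hw hFc
  have hi : ∀ c : EuclideanSpace ℝ (Fin d), Continuous fun u : UnitSphere d => ⟪c, u⟫_ℝ :=
    fun c => by fun_prop
  have h := integral_rotation_deriv w b (fun x => ⟪a, x⟫_ℝ * F ⟪w, x⟫_ℝ)
    (fun x => ⟪a, x⟫_ℝ • (f ⟪w, x⟫_ℝ • innerSL ℝ w) + F ⟪w, x⟫_ℝ • innerSL ℝ a) ?_ ?_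
  · have h1 : ∀ u : UnitSphere d, (⟪a, u⟫_ℝ • (f ⟪w, u⟫_ℝ • innerSL ℝ w) + F ⟪w, u⟫_ℝ • innerSL ℝ a)
        (⟪b, u⟫_ℝ • w - ⟪w, u⟫_ℝ • b) = ⟪a, u⟫_ℝ * ⟪b, u⟫_ℝ * f ⟪w, u⟫_ℝ
          - ⟪w, b⟫_ℝ * (⟪a, u⟫_ℝ * (⟪w, u⟫_ℝ * f ⟪w, u⟫_ℝ))
          + (⟪w, a⟫_ℝ * (⟪b, u⟫_ℝ * F ⟪w, u⟫_ℝ) - ⟪a, b⟫_ℝ * (⟪w, u⟫_ℝ * F ⟪w, u⟫_ℝ)) := fun u => by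
      have hww : ⟪w, w⟫_ℝ = 1 := by simp [hw]
      simp only [add_apply, smul_apply, innerSL_apply_apply,
        inner_sub_right, inner_smul_right, smul_eq_mul, hww]
      rw [real_inner_comm w a]
      ring
    have i1 : Integrable (fun u : UnitSphere d => ⟪a, u⟫_ℝ * ⟪b, u⟫_ℝ * f ⟪w, u⟫_ℝ)
        (surfaceMeasure d) := integrable_sphere (((hi a).mul (hi b)).mul hfz)
    have i2 : Integrable (fun u : UnitSphere d => ⟪a, u⟫_ℝ * (⟪w, u⟫_ℝ * f ⟪w, u⟫_ℝ))
        (surfaceMeasure d) := integrable_sphere ((hi a).mul ((hi w).mul hfz))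
    have i3 : Integrable (fun u : UnitSphere d => ⟪b, u⟫_ℝ * F ⟪w, u⟫_ℝ)
        (surfaceMeasure d) := integrable_sphere ((hi b).mul hFz)
    have i4 : Integrable (fun u : UnitSphere d => ⟪w, u⟫_ℝ * F ⟪w, u⟫_ℝ)
        (surfaceMeasure d) := integrable_sphere ((hi w).mul hFz)
    have i12 := i1.sub (i2.const_mul ⟪w, b⟫_ℝ)
    have i34 := (i3.const_mul ⟪w, a⟫_ℝ).sub (i4.const_mul ⟪a, b⟫_ℝ)
    simp only [Pi.sub_def] at i12 i34
    simp only [h1] at h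
    rw [integral_add i12 i34, integral_sub i1 (i2.const_mul _), integral_sub (i3.const_mul _) (i4.const_mul _),
      integral_const_mul, integral_const_mul, integral_const_mul,
      integral_inner_mul_zonal hw a (f := fun t => t * f t) (continuousOn_id.mul hf),
      integral_inner_mul_zonal hw b hFc] at h
    simp only [← mul_assoc, ← pow_two] at h ⊢
    linarith
  · intro u
    have h2 := (hF _ (inner_mem_Icc hw u)).comp_hasFDerivAt (u : EuclideanSpace ℝ (Fin d))
      (innerSL ℝ w).hasFDerivAt
    exact (innerSL ℝ a).hasFDerivAt.mul h2
  · exact ((hi a).smul (hfz.smul continuous_const)).add (hFz.smul continuous_const)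

/-- Stein's identity on the sphere, in trace form. -/
theorem integral_zonal_eq_add {d : ℕ} {w : EuclideanSpace ℝ (Fin d)}
    (hw : ‖w‖ = 1) {F f : ℝ → ℝ}
    (hF : ∀ t ∈ Set.Icc (-1 : ℝ) 1, HasDerivAt F (f t) t)
    (hf : ContinuousOn f (Set.Icc (-1) 1)) :
    ∫ u : UnitSphere d, f ⟪w, u⟫_ℝ ∂surfaceMeasure d =
      ∫ u : UnitSphere d, ⟪w, u⟫_ℝ ^ 2 * f ⟪w, u⟫_ℝ ∂surfaceMeasure d +
      ((d : ℝ) - 1) * ∫ u : UnitSphere d, ⟪w, u⟫_ℝ * F ⟪w, u⟫_ℝ ∂surfaceMeasure d := by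
  let e := EuclideanSpace.basisFun (Fin d) ℝ
  have hfz := continuous_zonal hw hf
  -- Taking the trace over an orthonormal basis uses `‖u‖ = 1`; the factor `d - 1` is the trace of
  -- the projection onto the complement of `w`.
  have hsum : ∀ u : UnitSphere d, f ⟪w, u⟫_ℝ = ∑ i, ⟪e i, u⟫_ℝ * ⟪e i, u⟫_ℝ * f ⟪w, u⟫_ℝ := fun u => by
    have := e.sum_inner_mul_inner (u : EuclideanSpace ℝ (Fin d)) u
    rw [real_inner_self_eq_norm_sq, norm_eq_of_mem_sphere u] at this
    rw [← Finset.sum_mul]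
    simp only [fun i => real_inner_comm (u : EuclideanSpace ℝ (Fin d)) (e i)] at this ⊢
    rw [this]; ring
  have hw2 : ∑ i, ⟪w, e i⟫_ℝ * ⟪w, e i⟫_ℝ = 1 := by
    have := e.sum_inner_mul_inner w w
    rw [real_inner_self_eq_norm_sq, hw, one_pow] at this
    simpa only [fun i => real_inner_comm w (e i)] using this
  have hee : ∑ i, ⟪e i, e i⟫_ℝ = (d : ℝ) := by simp
  have hint : ∀ i, Integrable (fun u : UnitSphere d => ⟪e i, u⟫_ℝ * ⟪e i, u⟫_ℝ * f ⟪w, u⟫_ℝ)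
      (surfaceMeasure d) := fun i => integrable_sphere (Continuous.mul (by fun_prop) hfz)
  rw [integral_congr_ae (ae_of_all _ hsum), integral_finsetSum _ fun i _ => hint i]
  simp only [integral_inner_mul_inner_mul_zonal_antideriv hw _ _ hF hf]
  rw [Finset.sum_add_distrib, ← Finset.sum_mul, ← Finset.sum_mul, Finset.sum_sub_distrib, hw2, hee]
  rw [one_mul]

/-- Second moments of a zonal weight on the sphere. -/
theorem integral_inner_mul_inner_mul_zonal {d : ℕ} (hd : 2 ≤ d) {w : EuclideanSpace ℝ (Fin d)}
    (hw : ‖w‖ = 1) (a b : EuclideanSpace ℝ (Fin d)) {f : ℝ → ℝ}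
    (hf : ContinuousOn f (Set.Icc (-1) 1)) :
    ∫ u : UnitSphere d, ⟪a, u⟫_ℝ * ⟪b, u⟫_ℝ * f ⟪w, u⟫_ℝ ∂surfaceMeasure d =
      ⟪w, a⟫_ℝ * ⟪w, b⟫_ℝ * ∫ u : UnitSphere d, ⟪w, u⟫_ℝ ^ 2 * f ⟪w, u⟫_ℝ ∂surfaceMeasure d +
      (⟪a, b⟫_ℝ - ⟪w, a⟫_ℝ * ⟪w, b⟫_ℝ) / ((d : ℝ) - 1) *
        (∫ u : UnitSphere d, f ⟪w, u⟫_ℝ ∂surfaceMeasure d -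
          ∫ u : UnitSphere d, ⟪w, u⟫_ℝ ^ 2 * f ⟪w, u⟫_ℝ ∂surfaceMeasure d) := by
  have hle : (-1 : ℝ) ≤ 1 := by norm_num
  -- Extending `f` continuously to the line gives an antiderivative with two-sided derivatives at
  -- `±1` too. The trace identity then eliminates this antiderivative.
  let f₁ : ℝ → ℝ := Set.IccExtend hle ((Set.Icc (-1 : ℝ) 1).domRestrict f)
  have hf₁ : Continuous f₁ := hf.domRestrict.Icc_extend'
  have he : ∀ u : UnitSphere d, f ⟪w, u⟫_ℝ = f₁ ⟪w, u⟫_ℝ := fun u => by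
    simp only [f₁, Set.IccExtend_of_mem _ _ (inner_mem_Icc hw u), Set.domRestrict_apply]
  have hF : ∀ t ∈ Set.Icc (-1 : ℝ) 1, HasDerivAt (fun t => ∫ x in (0 : ℝ)..t, f₁ x) (f₁ t) t :=
    fun t _ => hf₁.integral_hasStrictDerivAt 0 t |>.hasDerivAt
  simp only [he]
  rw [integral_inner_mul_inner_mul_zonal_antideriv hw a b hF hf₁.continuousOn,
    integral_zonal_eq_add hw hF hf₁.continuousOn]
  have : (d : ℝ) - 1 ≠ 0 := by
    have : (2 : ℝ) ≤ d := by exact_mod_cast hd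
    linarith
  field_simp
  ring

/-! ### Zonal integrals of powers: differential equation, recurrence, closed forms -/

/-- The integral of `(1 - 2 r ⟪w, u⟫ + r²) ^ (-k)` over the sphere. -/
noncomputable def zonalIntegral {d : ℕ} (w : EuclideanSpace ℝ (Fin d)) (k r : ℝ) : ℝ :=
  ∫ u : UnitSphere d, (1 - 2 * r * ⟪w, u⟫_ℝ + r ^ 2) ^ (-k) ∂surfaceMeasure d

/-- The base is affine in `t`, with values `(1 + r)²` at `-1` and `(1 - r)²` at `1`. -/
theorem zonal_base_pos {r t : ℝ} (hr : |r| < 1) (ht : t ∈ Set.Icc (-1 : ℝ) 1) :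
    0 < 1 - 2 * r * t + r ^ 2 := by
  rw [abs_lt] at hr
  obtain ⟨h1, h2⟩ := ht
  have h3 : 0 < (1 - r) ^ 2 := pow_pos (by linarith) 2
  have h4 : 0 < (1 + r) ^ 2 := pow_pos (by linarith) 2
  nlinarith [mul_nonneg (by linarith : 0 ≤ 1 + t) h3.le, mul_nonneg (by linarith : 0 ≤ 1 - t) h4.le,
    mul_nonneg (by linarith : 0 ≤ 1 + t) (by linarith : 0 ≤ 1 - t), sq_nonneg (r - t), sq_nonneg t]

theorem continuousOn_zonal_base_rpow {r : ℝ} (hr : |r| < 1) (k : ℝ) :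
    ContinuousOn (fun t => (1 - 2 * r * t + r ^ 2) ^ k) (Set.Icc (-1) 1) := fun t ht =>
  ((by fun_prop : Continuous fun t : ℝ => 1 - 2 * r * t + r ^ 2).continuousAt.rpow_const
    (.inl (zonal_base_pos hr ht).ne')).continuousWithinAt

theorem integrable_zonal_base_rpow {d : ℕ} {w : EuclideanSpace ℝ (Fin d)} (hw : ‖w‖ = 1)
    {r : ℝ} (hr : |r| < 1) (k : ℝ) :
    Integrable (fun u : UnitSphere d => (1 - 2 * r * ⟪w, u⟫_ℝ + r ^ 2) ^ k) (surfaceMeasure d) :=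
  integrable_sphere (continuous_zonal hw (continuousOn_zonal_base_rpow hr k))

theorem zonalIntegral_zero_right {d : ℕ} (w : EuclideanSpace ℝ (Fin d)) (k : ℝ) :
    zonalIntegral w k 0 = (surfaceMeasure d).real Set.univ := by
  simp [zonalIntegral]

theorem hasDerivAt_zonalIntegral_integral {d : ℕ} {w : EuclideanSpace ℝ (Fin d)} (hw : ‖w‖ = 1)
    {r : ℝ} (hr : |r| < 1) (k : ℝ) :
    HasDerivAt (zonalIntegral w k) (∫ u : UnitSphere d, k * (2 * ⟪w, u⟫_ℝ - 2 * r) *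
      (1 - 2 * r * ⟪w, u⟫_ℝ + r ^ 2) ^ (-k - 1) ∂surfaceMeasure d) r := by
  have hsub : ∀ x ∈ Metric.ball r (1 - |r|), |x| < 1 := fun x hx => by
    rw [Metric.mem_ball, Real.dist_eq] at hx
    calc |x| = |(x - r) + r| := by ring_nf
      _ ≤ |x - r| + |r| := abs_add_le _ _
      _ < 1 := by linarith
  refine hasDerivAt_integral_of_compactSpace (surfaceMeasure d) (ε := 1 - |r|)
    (f := fun (r : ℝ) (u : UnitSphere d) => (1 - 2 * r * ⟪w, u⟫_ℝ + r ^ 2) ^ (-k))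
    (f' := fun (r : ℝ) (u : UnitSphere d) => k * (2 * ⟪w, u⟫_ℝ - 2 * r) *
      (1 - 2 * r * ⟪w, u⟫_ℝ + r ^ 2) ^ (-k - 1))
    (by linarith) ?_ ?_ ?_
  · exact fun x hx => continuous_zonal hw (continuousOn_zonal_base_rpow (hsub x hx) (-k))
  · intro x hx u
    have h1 : HasDerivAt (fun y : ℝ => 1 - 2 * y * ⟪w, u⟫_ℝ + y ^ 2) (-(2 * ⟪w, u⟫_ℝ) + 2 * x) x := by
      have := ((((hasDerivAt_id x).const_mul 2).mul_const ⟪w, u⟫_ℝ).const_sub 1).fun_add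
        (hasDerivAt_pow 2 x)
      simpa using this
    have := h1.rpow_const (p := -k) (.inl (zonal_base_pos (hsub x hx) (inner_mem_Icc hw u)).ne')
    convert this using 1
    ring
  · refine ContinuousOn.mul (by fun_prop) ?_
    refine ContinuousOn.rpow_const (by fun_prop) ?_
    exact fun p hp => .inl (zonal_base_pos (hsub _ hp.1) (inner_mem_Icc hw p.2)).ne'

theorem rpow_add_one_smul {D : ℝ} (hD : 0 < D) (s : ℝ) : D ^ (s + 1) = D * D ^ s := by
  rw [Real.rpow_add_one hD.ne', mul_comm]

/-- With `D` the base, `r (2t - 2r) = (1 - r²) - D`, so the derivative of `D^(-k)` in `r` is a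
combination of `D^(-k-1)` and `D^(-k)`. -/
theorem hasDerivAt_zonalIntegral {d : ℕ} {w : EuclideanSpace ℝ (Fin d)} (hw : ‖w‖ = 1)
    {r : ℝ} (hr0 : 0 < r) (hr : r < 1) (k : ℝ) :
    HasDerivAt (zonalIntegral w k)
      (k / r * ((1 - r ^ 2) * zonalIntegral w (k + 1) r - zonalIntegral w k r)) r := by
  have hr' : |r| < 1 := by rwa [abs_of_pos hr0]
  convert hasDerivAt_zonalIntegral_integral hw hr' k using 1
  have i1 := (integrable_zonal_base_rpow hw hr' (-(k + 1))).const_mul (k / r * (1 - r ^ 2))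
  have i2 := (integrable_zonal_base_rpow hw hr' (-k)).const_mul (k / r)
  rw [mul_sub, ← mul_assoc, zonalIntegral, zonalIntegral, ← integral_const_mul,
    ← integral_const_mul, ← integral_sub i1 i2]
  congr 1
  funext u
  have hD := zonal_base_pos hr' (inner_mem_Icc hw u)
  have e1 : -k = (-k - 1) + 1 := by ring
  rw [show -(k + 1) = -k - 1 by ring]
  conv_lhs => rw [e1, rpow_add_one_smul hD]
  simp only [add_sub_cancel_right]
  field_simp
  ring

/-- Stein's identity for the powers of the base of the Poisson kernel. -/
theorem zonalIntegral_recurrence {d : ℕ} {w : EuclideanSpace ℝ (Fin d)} (hw : ‖w‖ = 1)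
    {r : ℝ} (hr0 : 0 < r) (hr : r < 1) (k : ℝ) :
    k * (2 * (1 + r ^ 2) * zonalIntegral w k r - (1 - r ^ 2) ^ 2 * zonalIntegral w (k + 1) r
        - zonalIntegral w (k - 1) r) =
      ((d : ℝ) - 1) * ((1 + r ^ 2) * zonalIntegral w k r - zonalIntegral w (k - 1) r) := by
  have hr' : |r| < 1 := by rwa [abs_of_pos hr0]
  have hF : ∀ t ∈ Set.Icc (-1 : ℝ) 1, HasDerivAt (fun t => (1 - 2 * r * t + r ^ 2) ^ (-k))
      (2 * r * k * (1 - 2 * r * t + r ^ 2) ^ (-k - 1)) t := fun t ht => by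
    have h1 : HasDerivAt (fun t : ℝ => 1 - 2 * r * t + r ^ 2) (-(2 * r)) t := by
      have := (((hasDerivAt_id t).const_mul (2 * r)).const_sub 1).add_const (r ^ 2)
      simpa using this
    convert h1.rpow_const (p := -k) (.inl (zonal_base_pos hr' ht).ne') using 1
    ring
  -- Here `F = D^(-k)`. Substituting `t = (1 + r² - D)/(2r)` turns each term of Stein's identity
  -- into zonal integrals.
  have h := integral_zonal_eq_add hw hF
    (continuousOn_const.mul (continuousOn_zonal_base_rpow hr' (-k - 1)))
  have i0 := integrable_zonal_base_rpow hw hr' (-k)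
  have i1 := integrable_zonal_base_rpow hw hr' (-(k + 1))
  have i2 := integrable_zonal_base_rpow hw hr' (-(k - 1))
  have hz : ∀ t ∈ Set.Icc (-1 : ℝ) 1, (1 - 2 * r * t + r ^ 2) ^ (-k) =
      (1 - 2 * r * t + r ^ 2) * (1 - 2 * r * t + r ^ 2) ^ (-(k + 1)) := fun t ht => by
    rw [← rpow_add_one_smul (zonal_base_pos hr' ht)]; ring_nf
  have hz2 : ∀ t ∈ Set.Icc (-1 : ℝ) 1, (1 - 2 * r * t + r ^ 2) ^ (-(k - 1)) =
      (1 - 2 * r * t + r ^ 2) * (1 - 2 * r * t + r ^ 2) ^ (-k) := fun t ht => by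
    rw [← rpow_add_one_smul (zonal_base_pos hr' ht)]; ring_nf
  have a1 : ∫ u : UnitSphere d, ⟪w, u⟫_ℝ ^ 2 * (2 * r * k * (1 - 2 * r * ⟪w, u⟫_ℝ + r ^ 2) ^ (-k - 1))
      ∂surfaceMeasure d = k / (2 * r) * ((1 + r ^ 2) ^ 2 * zonalIntegral w (k + 1) r
        - 2 * (1 + r ^ 2) * zonalIntegral w k r + zonalIntegral w (k - 1) r) := by
    have j := (i1.const_mul ((1 + r ^ 2) ^ 2)).sub (i0.const_mul (2 * (1 + r ^ 2)))
    simp only [Pi.sub_def] at j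
    simp only [zonalIntegral]
    rw [← integral_const_mul, ← integral_const_mul, ← integral_sub (i1.const_mul _) (i0.const_mul _),
      ← integral_add j i2, ← integral_const_mul]
    congr 1
    funext u
    have ht := inner_mem_Icc hw u
    rw [hz2 _ ht, hz _ ht, show -(k + 1) = -k - 1 by ring]
    field_simp
    ring
  have a2 : ∫ u : UnitSphere d, ⟪w, u⟫_ℝ * (1 - 2 * r * ⟪w, u⟫_ℝ + r ^ 2) ^ (-k)
      ∂surfaceMeasure d = 1 / (2 * r) * ((1 + r ^ 2) * zonalIntegral w k r
        - zonalIntegral w (k - 1) r) := by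
    simp only [zonalIntegral]
    rw [← integral_const_mul, ← integral_sub (i0.const_mul _) i2, ← integral_const_mul]
    congr 1
    funext u
    rw [hz2 _ (inner_mem_Icc hw u)]
    field_simp
    ring
  have a3 : ∫ u : UnitSphere d, 2 * r * k * (1 - 2 * r * ⟪w, u⟫_ℝ + r ^ 2) ^ (-k - 1)
      ∂surfaceMeasure d = 2 * r * k * zonalIntegral w (k + 1) r := by
    rw [integral_const_mul, zonalIntegral, show -(k + 1) = -k - 1 by ring]
  rw [a1, a2, a3] at h
  field_simp at h
  linarith

theorem eq_of_hasDerivAt_zero {f : ℝ → ℝ} {r : ℝ} (hr : 0 < r)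
    (hc : ContinuousOn f (Set.Icc 0 r)) (hd : ∀ x ∈ Set.Ioo 0 r, HasDerivAt f 0 x) :
    f r = f 0 := by
  obtain ⟨c, -, h⟩ := exists_hasDerivAt_eq_slope f (fun _ => 0) hr hc hd
  have := (div_eq_zero_iff.1 h.symm).resolve_right (by linarith)
  linarith

/-- The Poisson kernel has total mass one, and the Newtonian potential is constant inside the
sphere. -/
theorem zonalIntegral_closed_forms {d : ℕ} (hd : 2 ≤ d) {w : EuclideanSpace ℝ (Fin d)}
    (hw : ‖w‖ = 1) {r : ℝ} (hr0 : 0 < r) (hr : r < 1) :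
    (1 - r ^ 2) * zonalIntegral w (d / 2) r = (surfaceMeasure d).real Set.univ ∧
      zonalIntegral w (d / 2 - 1) r = (surfaceMeasure d).real Set.univ := by
  set A := (surfaceMeasure d).real Set.univ
  set h : ℝ → ℝ := fun x => (1 - x ^ 2) * zonalIntegral w (d / 2) x with hh
  set m : ℝ → ℝ := fun x => zonalIntegral w (d / 2 - 1) x with hm
  have hMc : ∀ k, ContinuousOn (zonalIntegral w k) (Set.Icc 0 r) := fun k x hx =>
    (hasDerivAt_zonalIntegral_integral hw (by rw [abs_of_nonneg hx.1]; linarith [hx.2])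
      k).continuousAt.continuousWithinAt
  have hhc : ContinuousOn h (Set.Icc 0 r) := ContinuousOn.mul (by fun_prop) (hMc _)
  have hmc : ContinuousOn m (Set.Icc 0 r) := hMc _
  have hm' : ∀ x ∈ Set.Ioo 0 r, HasDerivAt m ((d / 2 - 1) / x * (h x - m x)) x := fun x hx => by
    have := hasDerivAt_zonalIntegral hw hx.1 (hx.2.trans hr) (d / 2 - 1)
    simpa only [sub_add_cancel] using this
  -- Differentiation brings in the exponent `d/2 + 1`; the recurrence at `k = d/2` trades it for
  -- `d/2` and `d/2 - 1`, closing the system.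
  have hh' : ∀ x ∈ Set.Ioo 0 r, HasDerivAt h ((d / 2 - 1) / x * (m x - h x)) x := fun x hx => by
    have h1 := hasDerivAt_zonalIntegral hw hx.1 (hx.2.trans hr) (d / 2)
    have h2 := zonalIntegral_recurrence hw hx.1 (hx.2.trans hr) (d / 2)
    have h3 := ((hasDerivAt_pow 2 x).const_sub 1).fun_mul h1
    refine h3.congr_deriv ?_
    have hx0 := hx.1.ne'
    simp only [hh, hm]
    generalize zonalIntegral w (d / 2) x = M₁ at h2 ⊢
    generalize zonalIntegral w (d / 2 + 1) x = M₂ at h2 ⊢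
    generalize zonalIntegral w (d / 2 - 1) x = M₀ at h2 ⊢
    field_simp
    push_cast
    linear_combination (-2 : ℝ) * h2
  have hs : h r + m r = h 0 + m 0 := eq_of_hasDerivAt_zero (f := fun x => h x + m x) hr0
    (hhc.add hmc) fun x hx => ((hh' x hx).fun_add (hm' x hx)).congr_deriv (by ring)
  -- Since `(h - m)' = -((d - 2)/x)(h - m)`, the integrating factor is `x^(d-2)`. As `h 0 = m 0`,
  -- the resulting constant is zero, also for `d = 2`.
  obtain ⟨n, rfl⟩ : ∃ n, d = n + 2 := ⟨d - 2, by omega⟩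
  have hdif : r ^ n * (h r - m r) = 0 ^ n * (h 0 - m 0) :=
    eq_of_hasDerivAt_zero (f := fun x => x ^ n * (h x - m x)) hr0
    (ContinuousOn.mul (by fun_prop) (hhc.sub hmc)) fun x hx =>
      ((hasDerivAt_pow n x).fun_mul ((hh' x hx).fun_sub (hm' x hx))).congr_deriv (by
        have hx0 := hx.1.ne'
        rcases n with _ | n
        · simp
        · simp only [Nat.add_sub_cancel]
          push_cast
          field_simp
          ring)
  have h0 : h 0 = A := by simp [hh, zonalIntegral_zero_right, A]
  have m0 : m 0 = A := by simp [hm, zonalIntegral_zero_right, A]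
  rw [h0, m0] at hs
  rw [h0, m0, sub_self, mul_zero] at hdif
  have := (mul_eq_zero.1 hdif).resolve_left (pow_pos hr0 n).ne'
  constructor <;> linarith

/-! ### Moments of the Poisson kernel along its pole -/

/-- The Poisson kernel of the unit ball, as a function of the inner product of the directions. -/
noncomputable def poissonWeight (d : ℕ) (r t : ℝ) : ℝ :=
  (1 - r ^ 2) / (1 - 2 * r * t + r ^ 2) ^ ((d : ℝ) / 2)

theorem continuousOn_poissonWeight (d : ℕ) {r : ℝ} (hr : |r| < 1) :
    ContinuousOn (poissonWeight d r) (Set.Icc (-1) 1) :=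
  continuousOn_const.div (continuousOn_zonal_base_rpow hr _) fun _ ht =>
    (Real.rpow_pos_of_pos (zonal_base_pos hr ht) _).ne'

theorem poissonWeight_eq (d : ℕ) {r t : ℝ} (hr : |r| < 1) (ht : t ∈ Set.Icc (-1 : ℝ) 1) :
    poissonWeight d r t = (1 - r ^ 2) * (1 - 2 * r * t + r ^ 2) ^ (-((d : ℝ) / 2)) := by
  rw [poissonWeight, Real.rpow_neg (zonal_base_pos hr ht).le, div_eq_mul_inv]

theorem integral_sq_inner {d : ℕ} (hd : 2 ≤ d) {w : EuclideanSpace ℝ (Fin d)} (hw : ‖w‖ = 1) :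
    ∫ u : UnitSphere d, ⟪w, u⟫_ℝ ^ 2 ∂surfaceMeasure d =
      (surfaceMeasure d).real Set.univ / d := by
  have h := integral_zonal_eq_add hw (F := fun t => t) (f := fun _ => 1)
    (fun t _ => hasDerivAt_id t) continuousOn_const
  simp only [mul_one, ← pow_two, integral_const, smul_eq_mul] at h
  have : (d : ℝ) ≠ 0 := by positivity
  field_simp
  linarith

theorem integral_pow_four_inner {d : ℕ} (hd : 2 ≤ d) {w : EuclideanSpace ℝ (Fin d)}
    (hw : ‖w‖ = 1) :
    ∫ u : UnitSphere d, ⟪w, u⟫_ℝ ^ 4 ∂surfaceMeasure d =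
      3 * (surfaceMeasure d).real Set.univ / (d * (d + 2)) := by
  have h := integral_zonal_eq_add hw (F := fun t => t ^ 3) (f := fun t => 3 * t ^ 2)
    (fun t _ => by simpa using hasDerivAt_pow 3 t) (by fun_prop)
  simp only [mul_left_comm _ (3 : ℝ), ← pow_add, ← pow_succ', integral_const_mul,
    integral_sq_inner hd hw] at h
  norm_num at h
  have : (d : ℝ) ≠ 0 := by positivity
  field_simp at h ⊢
  linarith

theorem integral_poissonWeight {d : ℕ} (hd : 2 ≤ d) {w : EuclideanSpace ℝ (Fin d)}
    (hw : ‖w‖ = 1) {r : ℝ} (hr0 : 0 ≤ r) (hr : r < 1) :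
    ∫ u : UnitSphere d, poissonWeight d r ⟪w, u⟫_ℝ ∂surfaceMeasure d =
      (surfaceMeasure d).real Set.univ := by
  rcases hr0.eq_or_lt with rfl | hr0
  · simp [poissonWeight]
  · have hr' : |r| < 1 := by rwa [abs_of_pos hr0]
    simp only [fun u => poissonWeight_eq d hr' (inner_mem_Icc hw u)]
    rw [integral_const_mul, ← (zonalIntegral_closed_forms hd hw hr0 hr).1, zonalIntegral]

theorem integral_inner_mul_poissonWeight {d : ℕ} (hd : 2 ≤ d) {w : EuclideanSpace ℝ (Fin d)}
    (hw : ‖w‖ = 1) {r : ℝ} (hr0 : 0 ≤ r) (hr : r < 1) :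
    ∫ u : UnitSphere d, ⟪w, u⟫_ℝ * poissonWeight d r ⟪w, u⟫_ℝ ∂surfaceMeasure d =
      r * (surfaceMeasure d).real Set.univ := by
  rcases hr0.eq_or_lt with rfl | hr0
  -- At `r = 0` one cannot divide by `r`; Stein's identity with constant `F` shows that the mean
  -- vanishes.
  · have h := integral_zonal_eq_add hw (F := fun _ => 1) (f := fun _ => 0)
      (fun t _ => hasDerivAt_const t 1) continuousOn_const
    have : (d : ℝ) - 1 ≠ 0 := by
      have : (2 : ℝ) ≤ d := by exact_mod_cast hd
      linarith
    simpa [poissonWeight, this] using h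
  · have hr' : |r| < 1 := by rwa [abs_of_pos hr0]
    obtain ⟨h1, h2⟩ := zonalIntegral_closed_forms hd hw hr0 hr
    have i1 := integrable_zonal_base_rpow hw hr' (-((d : ℝ) / 2))
    have i2 := integrable_zonal_base_rpow hw hr' (-((d : ℝ) / 2 - 1))
    have e : ∫ u : UnitSphere d, ⟪w, u⟫_ℝ * poissonWeight d r ⟪w, u⟫_ℝ ∂surfaceMeasure d =
        (1 - r ^ 2) / (2 * r) * ((1 + r ^ 2) * zonalIntegral w (d / 2) r
          - zonalIntegral w (d / 2 - 1) r) := by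
      simp only [zonalIntegral]
      rw [← integral_const_mul, ← integral_sub (i1.const_mul _) i2, ← integral_const_mul]
      congr 1
      funext u
      rw [poissonWeight_eq d hr' (inner_mem_Icc hw u),
        show -((d : ℝ) / 2 - 1) = -((d : ℝ) / 2) + 1 by ring,
        rpow_add_one_smul (zonal_base_pos hr' (inner_mem_Icc hw u))]
      field_simp
      ring
    rw [e, h2]
    field_simp
    linear_combination (1 + r ^ 2) * h1

theorem integral_sq_inner_mul_poissonWeight {d : ℕ} (hd : 2 ≤ d) {w : EuclideanSpace ℝ (Fin d)}
    (hw : ‖w‖ = 1) {r : ℝ} (hr0 : 0 ≤ r) (hr : r < 1) :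
    ∫ u : UnitSphere d, ⟪w, u⟫_ℝ ^ 2 * poissonWeight d r ⟪w, u⟫_ℝ ∂surfaceMeasure d =
      (r ^ 2 + (1 - r ^ 2) / d) * (surfaceMeasure d).real Set.univ := by
  have hd0 : (d : ℝ) ≠ 0 := by positivity
  rcases hr0.eq_or_lt with rfl | hr0
  · simp [poissonWeight, integral_sq_inner hd hw]
    ring
  · have hr' : |r| < 1 := by rwa [abs_of_pos hr0]
    obtain ⟨h1, h2⟩ := zonalIntegral_closed_forms hd hw hr0 hr
    -- The factor `t²` brings in the exponent `d/2 - 2`, which this instance expresses through the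
    -- two known integrals.
    have h3 := zonalIntegral_recurrence hw hr0 hr ((d : ℝ) / 2 - 1)
    rw [sub_add_cancel, h2] at h3
    have i1 := integrable_zonal_base_rpow hw hr' (-((d : ℝ) / 2))
    have i2 := integrable_zonal_base_rpow hw hr' (-((d : ℝ) / 2 - 1))
    have i3 := integrable_zonal_base_rpow hw hr' (-((d : ℝ) / 2 - 1 - 1))
    have e : ∫ u : UnitSphere d, ⟪w, u⟫_ℝ ^ 2 * poissonWeight d r ⟪w, u⟫_ℝ ∂surfaceMeasure d =
        (1 - r ^ 2) / (4 * r ^ 2) * ((1 + r ^ 2) ^ 2 * zonalIntegral w (d / 2) r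
          - 2 * (1 + r ^ 2) * zonalIntegral w (d / 2 - 1) r
          + zonalIntegral w (d / 2 - 1 - 1) r) := by
      have j := (i1.const_mul ((1 + r ^ 2) ^ 2)).sub (i2.const_mul (2 * (1 + r ^ 2)))
      simp only [Pi.sub_def] at j
      simp only [zonalIntegral]
      rw [← integral_const_mul, ← integral_const_mul,
        ← integral_sub (i1.const_mul _) (i2.const_mul _), ← integral_add j i3, ← integral_const_mul]
      congr 1
      funext u
      have hD := zonal_base_pos hr' (inner_mem_Icc hw u)
      rw [poissonWeight_eq d hr' (inner_mem_Icc hw u),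
        show -((d : ℝ) / 2 - 1 - 1) = -((d : ℝ) / 2) + 1 + 1 by ring,
        show -((d : ℝ) / 2 - 1) = -((d : ℝ) / 2) + 1 by ring, rpow_add_one_smul hD,
        rpow_add_one_smul hD, rpow_add_one_smul hD]
      field_simp
      ring
    rw [e, h2]
    generalize (surfaceMeasure d).real Set.univ = A at h1 h3 ⊢
    generalize zonalIntegral w (d / 2) r = M₁ at h1 h3 ⊢
    generalize zonalIntegral w (d / 2 - 1 - 1) r = M₀ at h3 ⊢
    field_simp
    linear_combination 2 * (1 - r ^ 2) * h3 +
      (d * (1 + r ^ 2) ^ 2 + (d - 2) * (1 - r ^ 2) ^ 2) * h1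

/-! ### Total area and moments of the uniform distribution -/

theorem surfaceMeasure_real_univ {d : ℕ} (hd : 2 ≤ d) :
    (surfaceMeasure d).real Set.univ = surfaceArea d := by
  have hd0 : 0 < (d : ℝ) := by positivity
  have : Nonempty (Fin d) := ⟨⟨0, by omega⟩⟩
  rw [surfaceMeasure, Measure.toSphere_real_apply_univ, measureReal_def,
    EuclideanSpace.volume_ball, finrank_euclideanSpace, surfaceArea]
  simp only [Fintype.card_fin, ENNReal.ofReal_one, one_pow, one_mul]
  rw [ENNReal.toReal_ofReal (by positivity), Real.Gamma_add_one (by positivity),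
    Real.sqrt_eq_rpow, ← Real.rpow_natCast, ← Real.rpow_mul Real.pi_pos.le]
  have : 0 < Real.Gamma ((d : ℝ) / 2) := Real.Gamma_pos_of_pos (by positivity)
  rw [show 1 / 2 * (d : ℝ) = d / 2 by ring]
  field_simp

theorem surfaceArea_pos {d : ℕ} (hd : 2 ≤ d) : 0 < surfaceArea d := by
  have : 0 < Real.Gamma ((d : ℝ) / 2) := Real.Gamma_pos_of_pos (by positivity)
  unfold surfaceArea
  positivity

/-- Second moments of the uniform distribution on the sphere. -/
theorem integral_inner_mul_inner {d : ℕ} (hd : 2 ≤ d) (a b : EuclideanSpace ℝ (Fin d)) :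
    ∫ u : UnitSphere d, ⟪a, u⟫_ℝ * ⟪b, u⟫_ℝ ∂surfaceMeasure d =
      surfaceArea d / d * ⟪a, b⟫_ℝ := by
  have hw : ‖EuclideanSpace.single (⟨0, by omega⟩ : Fin d) (1 : ℝ)‖ = 1 := by simp
  have h := integral_inner_mul_inner_mul_zonal hd hw a b (f := fun _ => 1) continuousOn_const
  simp only [mul_one, integral_sq_inner hd hw, integral_const, surfaceMeasure_real_univ hd,
    smul_eq_mul] at h
  rw [h]
  have h1 : (d : ℝ) ≠ 0 := by positivity
  have h2 : (d : ℝ) - 1 ≠ 0 := by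
    have : (2 : ℝ) ≤ d := by exact_mod_cast hd
    linarith
  field_simp
  ring

theorem integral_inner_mul_inner_mul_sq {d : ℕ} (hd : 2 ≤ d) (a b w : EuclideanSpace ℝ (Fin d)) :
    ∫ u : UnitSphere d, ⟪a, u⟫_ℝ * ⟪b, u⟫_ℝ * ⟪w, u⟫_ℝ ^ 2 ∂surfaceMeasure d =
      surfaceArea d / (d * (d + 2)) * (⟪a, b⟫_ℝ * ⟪w, w⟫_ℝ + 2 * ⟪w, a⟫_ℝ * ⟪w, b⟫_ℝ) := by
  have key : ∀ w : EuclideanSpace ℝ (Fin d), ‖w‖ = 1 →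
      ∫ u : UnitSphere d, ⟪a, u⟫_ℝ * ⟪b, u⟫_ℝ * ⟪w, u⟫_ℝ ^ 2 ∂surfaceMeasure d =
      surfaceArea d / (d * (d + 2)) * (⟪a, b⟫_ℝ + 2 * ⟪w, a⟫_ℝ * ⟪w, b⟫_ℝ) := fun w hw => by
    have h := integral_inner_mul_inner_mul_zonal hd hw a b (f := fun t => t ^ 2) (by fun_prop)
    simp only [← pow_add, Nat.reduceAdd, integral_pow_four_inner hd hw, integral_sq_inner hd hw,
      surfaceMeasure_real_univ hd] at h
    rw [h]
    have h1 : (d : ℝ) ≠ 0 := by positivity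
    have h2 : (d : ℝ) - 1 ≠ 0 := by
      have : (2 : ℝ) ≤ d := by exact_mod_cast hd
      linarith
    field_simp
    ring
  by_cases hw : w = 0
  · simp [hw]
  have hn : ‖w‖ ≠ 0 := by simpa using hw
  -- Both sides are homogeneous of degree two in `w`, so the unit case suffices.
  have h := key (‖w‖⁻¹ • w) (by rw [norm_smul, norm_inv, norm_norm, inv_mul_cancel₀ hn])
  have e : ∀ u : UnitSphere d, ⟪a, u⟫_ℝ * ⟪b, u⟫_ℝ * ⟪‖w‖⁻¹ • w, u⟫_ℝ ^ 2 =
      (‖w‖⁻¹) ^ 2 * (⟪a, u⟫_ℝ * ⟪b, u⟫_ℝ * ⟪w, u⟫_ℝ ^ 2) := fun u => by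
    rw [real_inner_smul_left]; ring
  rw [integral_congr_ae (ae_of_all _ e), integral_const_mul] at h
  simp only [real_inner_smul_left] at h
  rw [real_inner_self_eq_norm_sq]
  field_simp at h ⊢
  linarith

/-- Fourth moments of the uniform distribution on the sphere. -/
theorem integral_inner_mul_four {d : ℕ} (hd : 2 ≤ d) (a b w z : EuclideanSpace ℝ (Fin d)) :
    ∫ u : UnitSphere d, ⟪a, u⟫_ℝ * ⟪b, u⟫_ℝ * (⟪w, u⟫_ℝ * ⟪z, u⟫_ℝ) ∂surfaceMeasure d =
      surfaceArea d / (d * (d + 2)) * (⟪a, b⟫_ℝ * ⟪w, z⟫_ℝ + ⟪a, w⟫_ℝ * ⟪b, z⟫_ℝ +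
        ⟪a, z⟫_ℝ * ⟪b, w⟫_ℝ) := by
  have h1 := integral_inner_mul_inner_mul_sq hd a b (w + z)
  have h2 := integral_inner_mul_inner_mul_sq hd a b (w - z)
  have i1 : Integrable (fun u : UnitSphere d => ⟪a, u⟫_ℝ * ⟪b, u⟫_ℝ * ⟪w + z, u⟫_ℝ ^ 2)
    (surfaceMeasure d) := integrable_sphere (by fun_prop)
  have i2 : Integrable (fun u : UnitSphere d => ⟪a, u⟫_ℝ * ⟪b, u⟫_ℝ * ⟪w - z, u⟫_ℝ ^ 2)
    (surfaceMeasure d) := integrable_sphere (by fun_prop)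
  -- Polarization of the quadratic form in `w`.
  have e : ∀ u : UnitSphere d, ⟪a, u⟫_ℝ * ⟪b, u⟫_ℝ * (⟪w, u⟫_ℝ * ⟪z, u⟫_ℝ) = (1 / 4) *
      (⟪a, u⟫_ℝ * ⟪b, u⟫_ℝ * ⟪w + z, u⟫_ℝ ^ 2 - ⟪a, u⟫_ℝ * ⟪b, u⟫_ℝ * ⟪w - z, u⟫_ℝ ^ 2) :=
    fun u => by rw [inner_add_left, inner_sub_left]; ring
  simp only [e]
  rw [integral_const_mul, integral_sub i1 i2, h1, h2]
  simp only [inner_add_left, inner_sub_left, inner_add_right, inner_sub_right]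
  rw [real_inner_comm w z, real_inner_comm a w, real_inner_comm a z, real_inner_comm b w,
    real_inner_comm b z]
  ring

/-! ### Poisson moments in arbitrary directions -/

theorem integral_inner_mul_poissonWeight_of_unit {d : ℕ} (hd : 2 ≤ d)
    {w : EuclideanSpace ℝ (Fin d)} (hw : ‖w‖ = 1) {r : ℝ} (hr0 : 0 ≤ r) (hr : r < 1)
    (a : EuclideanSpace ℝ (Fin d)) :
    ∫ u : UnitSphere d, ⟪a, u⟫_ℝ * poissonWeight d r ⟪w, u⟫_ℝ ∂surfaceMeasure d =
      surfaceArea d * (r * ⟪w, a⟫_ℝ) := by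
  rw [integral_inner_mul_zonal hw a (continuousOn_poissonWeight d (by rwa [abs_of_nonneg hr0])),
    integral_inner_mul_poissonWeight hd hw hr0 hr, surfaceMeasure_real_univ hd]
  ring

/-- The second moment along the pole is `r² + (1 - r²)/d`, and the rest of the trace, shared by `d -
1` directions, gives `(1 - r²)/d` each: an isotropic part plus `r²` along `w`. -/
theorem integral_inner_mul_inner_mul_poissonWeight {d : ℕ} (hd : 2 ≤ d)
    {w : EuclideanSpace ℝ (Fin d)} (hw : ‖w‖ = 1) {r : ℝ} (hr0 : 0 ≤ r) (hr : r < 1)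
    (a b : EuclideanSpace ℝ (Fin d)) :
    ∫ u : UnitSphere d, ⟪a, u⟫_ℝ * ⟪b, u⟫_ℝ * poissonWeight d r ⟪w, u⟫_ℝ ∂surfaceMeasure d =
      surfaceArea d * (r ^ 2 * (⟪w, a⟫_ℝ * ⟪w, b⟫_ℝ) + (1 - r ^ 2) / d * ⟪a, b⟫_ℝ) := by
  rw [integral_inner_mul_inner_mul_zonal hd hw a b
      (continuousOn_poissonWeight d (by rwa [abs_of_nonneg hr0])),
    integral_sq_inner_mul_poissonWeight hd hw hr0 hr, integral_poissonWeight hd hw hr0 hr,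
    surfaceMeasure_real_univ hd]
  have h1 : (d : ℝ) ≠ 0 := by positivity
  have h2 : (d : ℝ) - 1 ≠ 0 := by
    have : (2 : ℝ) ≤ d := by exact_mod_cast hd
    linarith
  field_simp
  ring

/-! ### The joint law of a pair and its mixed moments -/

theorem continuous_coords_apply {d : ℕ} (i : Fin d) :
    Continuous fun u : UnitSphere d => coords u i :=
  ((EuclideanSpace.proj i : EuclideanSpace ℝ (Fin d) →L[ℝ] ℝ).continuous).comp
    continuous_subtype_val

theorem coords_apply_eq_inner {d : ℕ} (i : Fin d) (u : UnitSphere d) :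
    coords u i = ⟪EuclideanSpace.single i (1 : ℝ), u⟫_ℝ := by
  simp [coords, EuclideanSpace.inner_single_left]

/-- The image of a unit vector under a matrix. -/
noncomputable def matrixImage {d : ℕ} (Q : Matrix (Fin d) (Fin d) ℝ) (v : UnitSphere d) :
    EuclideanSpace ℝ (Fin d) :=
  WithLp.toLp 2 (Q *ᵥ coords v)

theorem inner_matrixImage {d : ℕ} (Q : Matrix (Fin d) (Fin d) ℝ) (u v : UnitSphere d) :
    coords u ⬝ᵥ (Q *ᵥ coords v) = ⟪matrixImage Q v, u⟫_ℝ := by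
  simp [matrixImage, coords, PiLp.inner_apply, dotProduct]

/-- Rewrites a coordinate of the pole as a linear form in `v`, to which the uniform moment formulas
apply. -/
theorem inner_matrixImage_single {d : ℕ} (Q : Matrix (Fin d) (Fin d) ℝ) (v : UnitSphere d)
    (i : Fin d) :
    ⟪matrixImage Q v, EuclideanSpace.single i (1 : ℝ)⟫_ℝ =
      ⟪(WithLp.toLp 2 (Q i) : EuclideanSpace ℝ (Fin d)), v⟫_ℝ := by
  simp [matrixImage, coords, PiLp.inner_apply, Matrix.mulVec, dotProduct, mul_comm]

theorem norm_matrixImage {d : ℕ} {Q : Matrix (Fin d) (Fin d) ℝ}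
    (hQ : Q ∈ Matrix.orthogonalGroup (Fin d) ℝ) (v : UnitSphere d) : ‖matrixImage Q v‖ = 1 := by
  have h1 : Qᵀ * Q = 1 := (Matrix.mem_orthogonalGroup_iff' (Fin d) ℝ).1 hQ
  have h2 : (Q *ᵥ coords v) ⬝ᵥ (Q *ᵥ coords v) = coords v ⬝ᵥ coords v := by
    rw [Matrix.dotProduct_mulVec, Matrix.vecMul_mulVec, h1, Matrix.vecMul_one]
  have h3 : ‖matrixImage Q v‖ ^ 2 = ‖(v : EuclideanSpace ℝ (Fin d))‖ ^ 2 := by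
    rw [EuclideanSpace.norm_sq_eq, EuclideanSpace.norm_sq_eq]
    simpa [matrixImage, dotProduct, coords, pow_two] using h2
  rw [norm_eq_of_mem_sphere v, one_pow] at h3
  exact (pow_eq_one_iff_of_nonneg (norm_nonneg _) two_ne_zero).1 h3

theorem continuous_bsDensity {d : ℕ} {ρ : ℝ} (hρ : |ρ| < 1) {Q : Matrix (Fin d) (Fin d) ℝ}
    (hQ : Q ∈ Matrix.orthogonalGroup (Fin d) ℝ) :
    Continuous fun p : UnitSphere d × UnitSphere d => bsDensity ρ Q p.1 p.2 := by
  have hc : Continuous fun u : UnitSphere d => coords u := continuous_pi continuous_coords_apply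
  have hi : Continuous fun p : UnitSphere d × UnitSphere d =>
      coords p.1 ⬝ᵥ (Q *ᵥ coords p.2) :=
    (hc.comp continuous_fst).dotProduct (continuous_const.matrix_mulVec (hc.comp continuous_snd))
  exact continuous_const.mul ((continuousOn_poissonWeight d hρ).comp_continuous hi fun p => by
    rw [inner_matrixImage]
    exact inner_mem_Icc (norm_matrixImage hQ p.2) p.1)

theorem bsDensity_eq {d : ℕ} (ρ : ℝ) (Q : Matrix (Fin d) (Fin d) ℝ) (u v : UnitSphere d) :
    bsDensity ρ Q u v = 1 / surfaceArea d ^ 2 * poissonWeight d ρ ⟪matrixImage Q v, u⟫_ℝ := by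
  rw [← inner_matrixImage]; rfl

theorem bsDensity_nonneg {d : ℕ} {ρ : ℝ} (hρ : |ρ| < 1) {Q : Matrix (Fin d) (Fin d) ℝ}
    (hQ : Q ∈ Matrix.orthogonalGroup (Fin d) ℝ) (u v : UnitSphere d) :
    0 ≤ bsDensity ρ Q u v := by
  have h1 := zonal_base_pos hρ (inner_mem_Icc (norm_matrixImage hQ v) u)
  have h2 : 0 < 1 - ρ ^ 2 := by rw [sub_pos, sq_lt_one_iff_abs_lt_one]; exact hρ
  rw [bsDensity_eq, poissonWeight]
  positivity

/-- Integrals against the distribution with the Poisson type density as iterated integrals. -/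
theorem integral_bsMeasure {d : ℕ} {ρ : ℝ} (hρ : |ρ| < 1)
    {Q : Matrix (Fin d) (Fin d) ℝ} (hQ : Q ∈ Matrix.orthogonalGroup (Fin d) ℝ)
    {X : UnitSphere d × UnitSphere d → ℝ} (hX : Continuous X) :
    ∫ p, X p ∂bsMeasure ρ Q = 1 / surfaceArea d ^ 2 * ∫ v, ∫ u, X (u, v) *
      poissonWeight d ρ ⟪matrixImage Q v, u⟫_ℝ ∂surfaceMeasure d ∂surfaceMeasure d := by
  have hc := continuous_bsDensity hρ hQ
  rw [bsMeasure, integral_withDensity_eq_integral_toReal_smul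
    hc.measurable.ennreal_ofReal (ae_of_all _ fun _ => ENNReal.ofReal_lt_top)]
  simp only [ENNReal.toReal_ofReal (bsDensity_nonneg hρ hQ _ _), smul_eq_mul]
  have hi : Integrable (fun p : UnitSphere d × UnitSphere d => bsDensity ρ Q p.1 p.2 * X p)
      ((surfaceMeasure d).prod (surfaceMeasure d)) :=
    (hc.mul hX).integrable_of_hasCompactSupport (HasCompactSupport.of_compactSpace _)
  -- The inner integral is over `u`, where the weight is a Poisson kernel with fixed pole.
  rw [integral_prod_symm _ hi, ← integral_const_mul]
  simp only [← integral_const_mul, bsDensity_eq]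
  congr 1; funext v; congr 1; funext u; ring

/-- First moments of the entries of `u v'`. -/
theorem integral_coords_mul_coords_bsMeasure {d : ℕ} (hd : 2 ≤ d) {ρ : ℝ} (hρ0 : 0 ≤ ρ)
    (hρ1 : ρ < 1) {Q : Matrix (Fin d) (Fin d) ℝ} (hQ : Q ∈ Matrix.orthogonalGroup (Fin d) ℝ)
    (i j : Fin d) :
    ∫ p, coords p.1 i * coords p.2 j ∂bsMeasure ρ Q = ρ * Q i j / d := by
  have hA := surfaceArea_pos hd
  rw [integral_bsMeasure (by rwa [abs_of_nonneg hρ0]) hQ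
    (X := fun p => coords p.1 i * coords p.2 j) (((continuous_coords_apply i).comp continuous_fst).mul
      ((continuous_coords_apply j).comp continuous_snd))]
  have h : ∀ v : UnitSphere d, ∫ u : UnitSphere d, coords u i * coords v j *
      poissonWeight d ρ ⟪matrixImage Q v, u⟫_ℝ ∂surfaceMeasure d =
      surfaceArea d * ρ * (⟪(WithLp.toLp 2 (Q i) : EuclideanSpace ℝ (Fin d)), v⟫_ℝ *
        ⟪EuclideanSpace.single j (1 : ℝ), v⟫_ℝ) := fun v => by
    simp only [mul_right_comm _ (coords v j)]
    rw [integral_mul_const]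
    simp only [coords_apply_eq_inner]
    rw [integral_inner_mul_poissonWeight_of_unit hd (norm_matrixImage hQ v) hρ0 hρ1,
      inner_matrixImage_single]
    ring
  simp only [h]
  rw [integral_const_mul, integral_inner_mul_inner hd]
  simp only [EuclideanSpace.inner_single_right, RCLike.conj_to_real, one_mul]
  field_simp

/-- Second moments of the entries of `u v'`. -/
theorem integral_coords_mul_four_bsMeasure {d : ℕ} (hd : 2 ≤ d) {ρ : ℝ} (hρ0 : 0 ≤ ρ)
    (hρ1 : ρ < 1) {Q : Matrix (Fin d) (Fin d) ℝ} (hQ : Q ∈ Matrix.orthogonalGroup (Fin d) ℝ)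
    (i j k l : Fin d) :
    ∫ p, (coords p.1 i * coords p.2 j) * (coords p.1 k * coords p.2 l) ∂bsMeasure ρ Q =
      ρ ^ 2 / (d * (d + 2)) * ((1 : Matrix (Fin d) (Fin d) ℝ) i k *
        (1 : Matrix (Fin d) (Fin d) ℝ) j l + Q i j * Q k l + Q i l * Q k j) +
      (1 - ρ ^ 2) / d ^ 2 * ((1 : Matrix (Fin d) (Fin d) ℝ) i k *
        (1 : Matrix (Fin d) (Fin d) ℝ) j l) := by
  have hA := surfaceArea_pos hd
  -- Orthonormality of the rows evaluates one of the three pairings in the fourth moment formula.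
  have hQQ : ⟪(WithLp.toLp 2 (Q i) : EuclideanSpace ℝ (Fin d)), WithLp.toLp 2 (Q k)⟫_ℝ =
      (1 : Matrix (Fin d) (Fin d) ℝ) i k := by
    rw [← (Matrix.mem_orthogonalGroup_iff (Fin d) ℝ).1 hQ]
    simp [PiLp.inner_apply, Matrix.mul_apply, mul_comm]
  have hone : ∀ i k : Fin d, ⟪(EuclideanSpace.single i (1 : ℝ) : EuclideanSpace ℝ (Fin d)),
      EuclideanSpace.single k (1 : ℝ)⟫_ℝ = (1 : Matrix (Fin d) (Fin d) ℝ) i k := fun i k => by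
    simp [Matrix.one_apply, EuclideanSpace.inner_single_left]
  have hc : ∀ i, Continuous fun p : UnitSphere d × UnitSphere d => coords p.1 i :=
    fun i => (continuous_coords_apply i).comp continuous_fst
  have hc' : ∀ i, Continuous fun p : UnitSphere d × UnitSphere d => coords p.2 i :=
    fun i => (continuous_coords_apply i).comp continuous_snd
  rw [integral_bsMeasure (by rwa [abs_of_nonneg hρ0]) hQ
    (X := fun p => coords p.1 i * coords p.2 j * (coords p.1 k * coords p.2 l)) (((hc i).mul (hc' j)).mul ((hc k).mul (hc' l)))]
  have h : ∀ v : UnitSphere d, ∫ u : UnitSphere d, coords u i * coords v j *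
      (coords u k * coords v l) *
      poissonWeight d ρ ⟪matrixImage Q v, u⟫_ℝ ∂surfaceMeasure d =
      surfaceArea d * ρ ^ 2 * (⟪(WithLp.toLp 2 (Q i) : EuclideanSpace ℝ (Fin d)), v⟫_ℝ *
        ⟪(WithLp.toLp 2 (Q k) : EuclideanSpace ℝ (Fin d)), v⟫_ℝ *
        (⟪EuclideanSpace.single j (1 : ℝ), v⟫_ℝ * ⟪EuclideanSpace.single l (1 : ℝ), v⟫_ℝ)) +
      surfaceArea d * ((1 - ρ ^ 2) / d * (1 : Matrix (Fin d) (Fin d) ℝ) i k) *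
        (⟪EuclideanSpace.single j (1 : ℝ), v⟫_ℝ * ⟪EuclideanSpace.single l (1 : ℝ), v⟫_ℝ) :=
      fun v => by
    have e : ∀ u : UnitSphere d, coords u i * coords v j * (coords u k * coords v l) *
        poissonWeight d ρ ⟪matrixImage Q v, u⟫_ℝ = coords v j * coords v l *
        (coords u i * coords u k * poissonWeight d ρ ⟪matrixImage Q v, u⟫_ℝ) := fun u => by ring
    simp only [e]
    rw [integral_const_mul]
    simp only [coords_apply_eq_inner]
    rw [integral_inner_mul_inner_mul_poissonWeight hd (norm_matrixImage hQ v) hρ0 hρ1,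
      inner_matrixImage_single, inner_matrixImage_single, hone]
    ring
  simp only [h]
  rw [integral_add (integrable_sphere (by fun_prop)) (integrable_sphere (by fun_prop)),
    integral_const_mul, integral_const_mul, integral_inner_mul_inner hd,
    integral_inner_mul_four hd, hQQ, hone]
  simp only [EuclideanSpace.inner_single_right, RCLike.conj_to_real, one_mul]
  field_simp

/-! ### From the scalar to the multivariate central limit theorem -/

/-- The multivariate central limit theorem. -/
theorem tendstoInDistribution_multivariateGaussian {ι Ω : Type*} [Fintype ι] [DecidableEq ι]
    [MeasurableSpace Ω] {P : Measure Ω} [IsProbabilityMeasure P]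
    {X : ℕ → Ω → EuclideanSpace ℝ ι} {S : Matrix ι ι ℝ} (hS : S.PosSemidef)
    {m : EuclideanSpace ℝ ι} (hL2 : MemLp (X 0) 2 P)
    (hmean : ∀ t, ∫ ω, ⟪X 0 ω, t⟫_ℝ ∂P = ⟪m, t⟫_ℝ)
    (hvar : ∀ t : EuclideanSpace ℝ ι, Var[fun ω => ⟪X 0 ω, t⟫_ℝ; P] = t ⬝ᵥ (S *ᵥ t))
    (hindep : iIndepFun X P) (hident : ∀ i, IdentDistrib (X i) (X 0) P P) :
    TendstoInDistribution (fun (n : ℕ) ω => √(n : ℝ) •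
      ((n : ℝ)⁻¹ • ∑ k ∈ Finset.range n, X k ω - m)) atTop id (fun _ => P)
      (multivariateGaussian 0 S) := by
  have hX : ∀ k, AEMeasurable (X k) P := fun k => (hident k).aemeasurable_fst
  have hmeas : ∀ n : ℕ, AEMeasurable (fun ω => √(n : ℝ) •
      ((n : ℝ)⁻¹ • ∑ k ∈ Finset.range n, X k ω - m)) P := fun n =>
    (by fun_prop : Measurable fun x : EuclideanSpace ℝ ι =>
      √(n : ℝ) • ((n : ℝ)⁻¹ • x - m)).comp_aemeasurable
      (Finset.aemeasurable_fun_sum _ fun k _ => hX k)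
  refine ⟨hmeas, aemeasurable_id, ?_⟩
  -- Cramér–Wold: the characteristic function at `t` is that of the projection onto `t` at `1`, to
  -- which the scalar theorem applies.
  refine ProbabilityMeasure.tendsto_iff_tendsto_charFun.2 fun t => ?_
  let φ : EuclideanSpace ℝ ι → ℝ := fun x => ⟪x, t⟫_ℝ
  have hφ : Continuous φ := by fun_prop
  let Z : ℕ → Ω → ℝ := fun k ω => φ (X k ω)
  have hZL2 : MemLp (Z 0) 2 P := by
    have := (innerSL ℝ t).comp_memLp' hL2
    simpa [Z, φ, Function.comp_def, real_inner_comm] using this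
  have hclt := tendstoInDistribution_inv_sqrt_mul_sum_sub (P := P) (X := Z)
    (P' := gaussianReal 0 Var[Z 0; P].toNNReal) (Y := id) ⟨aemeasurable_id, by simp⟩ hZL2
    (hindep.comp (fun _ => φ) fun _ => hφ.measurable)
    (fun k => (hident k).comp hφ.measurable)
  have h1 := ProbabilityMeasure.tendsto_iff_tendsto_charFun.1 hclt.tendsto 1
  have hlim : charFun (Measure.map id (gaussianReal 0 Var[Z 0; P].toNNReal)) 1 =
      charFun (Measure.map id (multivariateGaussian 0 S)) t := by
    rw [Measure.map_id, Measure.map_id, charFun_gaussianReal, charFun_multivariateGaussian hS,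
      ← hvar t]
    rw [Real.coe_toNNReal _ (variance_nonneg _ _)]
    simp [Z, φ]
  have hseq : ∀ n : ℕ, charFun (P.map fun ω => (√(n : ℝ))⁻¹ *
      (∑ k ∈ Finset.range n, Z k ω - n * P[Z 0])) 1 =
      charFun (P.map fun ω => √(n : ℝ) • ((n : ℝ)⁻¹ • ∑ k ∈ Finset.range n, X k ω - m)) t := by
    intro n
    have hZm : AEMeasurable (fun ω => (√(n : ℝ))⁻¹ *
      (∑ k ∈ Finset.range n, Z k ω - n * P[Z 0])) P :=
      ((Finset.aemeasurable_fun_sum _ fun k _ => hφ.measurable.comp_aemeasurable (hX k)).sub_const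
        _).const_mul _
    rw [charFun_apply, charFun_apply, integral_map hZm (by fun_prop),
      integral_map (hmeas n) (by fun_prop)]
    congr 1
    funext ω
    have e0 : P[Z 0] = ⟪m, t⟫_ℝ := hmean t
    rw [e0]
    simp only [real_inner_smul_left, inner_sub_left, sum_inner, Z, φ]
    congr 3
    rcases n.eq_zero_or_pos with rfl | hn
    · simp
    · have hs : √(n : ℝ) ≠ 0 := (Real.sqrt_pos.2 (by exact_mod_cast hn)).ne'
      have hs2 : (n : ℝ) = √(n : ℝ) * √(n : ℝ) := (Real.mul_self_sqrt (by positivity)).symm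
      have hin : (inner ℝ ((√(n : ℝ))⁻¹ * (∑ k ∈ Finset.range n, ⟪X k ω, t⟫_ℝ - n * ⟪m, t⟫_ℝ)) 1 : ℝ)
        = (√(n : ℝ))⁻¹ * (∑ k ∈ Finset.range n, ⟪X k ω, t⟫_ℝ - n * ⟪m, t⟫_ℝ) := by simp
      rw [hin]
      generalize √(n : ℝ) = s at hs hs2 ⊢
      rw [hs2]
      field_simp
  have h2 : Tendsto (fun n : ℕ => charFun (P.map fun ω => (√(n : ℝ))⁻¹ *
      (∑ k ∈ Finset.range n, Z k ω - n * P[Z 0])) 1) atTop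
      (𝓝 (charFun (Measure.map id (gaussianReal 0 Var[Z 0; P].toNNReal)) 1)) := h1
  rw [hlim] at h2
  simp only [hseq] at h2
  exact h2

/-! ### The stacked sample, its covariance and the main theorem -/

/-- The stacked matrix `d u v'`. -/
noncomputable def stackedProduct {d : ℕ} (p : UnitSphere d × UnitSphere d) :
    EuclideanSpace ℝ (Fin (d * d)) :=
  stackColumns ((d : ℝ) • Matrix.vecMulVec (coords p.1) (coords p.2))

theorem stackedProduct_apply {d : ℕ} (p : UnitSphere d × UnitSphere d) (m : Fin (d * d)) :
    stackedProduct p m = d * (coords p.1 (finProdFinEquiv.symm m).2 *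
      coords p.2 (finProdFinEquiv.symm m).1) := by
  simp [stackedProduct, stackColumns, Matrix.vecMulVec_apply]

theorem continuous_stackedProduct {d : ℕ} : Continuous (stackedProduct (d := d)) := by
  refine (PiLp.continuous_toLp 2 _).comp (continuous_pi fun m => ?_)
  simp only [Matrix.smul_apply, Matrix.vecMulVec_apply]
  exact continuous_const.mul (((continuous_coords_apply _).comp continuous_fst).mul
    ((continuous_coords_apply _).comp continuous_snd))

theorem stackColumns_momentEstimator {d : ℕ} {Ω : Type*} (U V : ℕ → Ω → UnitSphere d) (n : ℕ)
    (ω : Ω) : stackColumns (momentEstimator U V n ω) =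
      (n : ℝ)⁻¹ • ∑ k ∈ Finset.range n, stackedProduct (U k ω, V k ω) := by
  ext m
  simp only [PiLp.smul_apply, WithLp.ofLp_sum, Finset.sum_apply, stackedProduct_apply, smul_eq_mul]
  simp only [stackColumns, momentEstimator, Matrix.smul_apply, Matrix.sum_apply,
    Matrix.vecMulVec_apply, smul_eq_mul, ← Finset.mul_sum]
  ring

/-- The product of the two Kronecker deltas is `1` exactly when `m = n`, so one expression, second
moment minus product of means, covers both cases. -/
theorem asymptoticCov_apply {d : ℕ} (hd : 2 ≤ d) (ρ : ℝ) (Q : Matrix (Fin d) (Fin d) ℝ)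
    (m n : Fin (d * d)) :
    asymptoticCov ρ Q m n =
      let i := (finProdFinEquiv.symm m).2
      let j := (finProdFinEquiv.symm m).1
      let k := (finProdFinEquiv.symm n).2
      let l := (finProdFinEquiv.symm n).1
      d ^ 2 * (ρ ^ 2 / (d * (d + 2)) * ((1 : Matrix (Fin d) (Fin d) ℝ) i k *
        (1 : Matrix (Fin d) (Fin d) ℝ) j l + Q i j * Q k l + Q i l * Q k j) +
      (1 - ρ ^ 2) / d ^ 2 * ((1 : Matrix (Fin d) (Fin d) ℝ) i k *
        (1 : Matrix (Fin d) (Fin d) ℝ) j l)) - (ρ * Q i j) * (ρ * Q k l) := by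
  have h1 : (d : ℝ) ≠ 0 := by positivity
  have h2 : (d : ℝ) + 2 ≠ 0 := by positivity
  by_cases hmn : m = n
  · subst hmn
    simp only [asymptoticCov, Matrix.of_apply, if_true, Matrix.one_apply_eq]
    field_simp
    ring
  · have h0 : (1 : Matrix (Fin d) (Fin d) ℝ) (finProdFinEquiv.symm m).2 (finProdFinEquiv.symm n).2 *
        (1 : Matrix (Fin d) (Fin d) ℝ) (finProdFinEquiv.symm m).1 (finProdFinEquiv.symm n).1 = 0 := by
      by_cases ha : (finProdFinEquiv.symm m).2 = (finProdFinEquiv.symm n).2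
      · have hb : (finProdFinEquiv.symm m).1 ≠ (finProdFinEquiv.symm n).1 := fun hb =>
          hmn (finProdFinEquiv.symm.injective (Prod.ext hb ha))
        rw [Matrix.one_apply_ne hb, mul_zero]
      · rw [Matrix.one_apply_ne ha, zero_mul]
    simp only [asymptoticCov, Matrix.of_apply, if_neg hmn, h0]
    field_simp
    ring

theorem asymptoticCov_isHermitian {d : ℕ} (hd : 2 ≤ d) (ρ : ℝ) (Q : Matrix (Fin d) (Fin d) ℝ) :
    (asymptoticCov ρ Q).IsHermitian := by
  ext m n
  rw [Matrix.conjTranspose_apply, star_trivial, asymptoticCov_apply hd, asymptoticCov_apply hd]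
  have hs : ∀ i k, (1 : Matrix (Fin d) (Fin d) ℝ) i k = (1 : Matrix (Fin d) (Fin d) ℝ) k i :=
    fun i k => congrFun (congrFun Matrix.transpose_one k) i
  dsimp only
  rw [hs (finProdFinEquiv.symm n).1, hs (finProdFinEquiv.symm n).2]
  ring

theorem stackColumns_finProdFinEquiv {d : ℕ} (A : Matrix (Fin d) (Fin d) ℝ) (i k : Fin d) :
    stackColumns A (finProdFinEquiv (k, i)) = A i k := by
  simp only [stackColumns, Equiv.symm_apply_apply]

theorem theorem4 {d : ℕ} (hd : 2 ≤ d) (ρ : ℝ) (hρ0 : 0 ≤ ρ) (hρ1 : ρ < 1)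
    (Q : Matrix (Fin d) (Fin d) ℝ) (hQ : Q ∈ Matrix.orthogonalGroup (Fin d) ℝ)
    {Ω : Type*} [MeasurableSpace Ω] (P : Measure Ω) [IsProbabilityMeasure P]
    (U V : ℕ → Ω → UnitSphere d)
    (hlaw : ∀ j, HasLaw (fun ω => (U j ω, V j ω)) (bsMeasure ρ Q) P)
    (hindep : iIndepFun (fun j ω => (U j ω, V j ω)) P) :
    -- unbiasedness, for every sample size
    (∀ n : ℕ, 1 ≤ n → ∀ i k : Fin d,
      Integrable (fun ω => momentEstimator U V n ω i k) P ∧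
        ∫ ω, momentEstimator U V n ω i k ∂P = (ρ • Q) i k) ∧
    -- consistency: convergence in probability, in the Euclidean distance of the entries
    TendstoInMeasure P (fun n ω => stackColumns (momentEstimator U V n ω)) atTop
      (fun _ => stackColumns (ρ • Q)) ∧
    -- asymptotic normality
    (asymptoticCov ρ Q).PosSemidef ∧
    TendstoInDistribution
      (fun (n : ℕ) ω =>
        √(n : ℝ) • (stackColumns (momentEstimator U V n ω) - stackColumns (ρ • Q)))
      atTop id (fun _ => P) (multivariateGaussian 0 (asymptoticCov ρ Q)) := by
  have hd0 : (d : ℝ) ≠ 0 := by positivity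
  let X : ℕ → Ω → EuclideanSpace ℝ (Fin (d * d)) := fun k ω => stackedProduct (U k ω, V k ω)
  have hYm : Measurable (stackedProduct (d := d)) := continuous_stackedProduct.measurable
  have hXm : ∀ k, AEMeasurable (X k) P := fun k => hYm.comp_aemeasurable (hlaw k).aemeasurable
  -- Compactness bounds the summands, which settles every integrability question below.
  obtain ⟨C, hC⟩ := (isCompact_univ (X := UnitSphere d × UnitSphere d)).exists_bound_of_continuousOn
    (continuous_stackedProduct (d := d)).continuousOn
  have hL2 : ∀ k, MemLp (X k) 2 P := fun k =>
    .of_bound (hXm k).aestronglyMeasurable C (ae_of_all _ fun ω => hC _ trivial)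
  have hident : ∀ k, IdentDistrib (X k) (X 0) P P := fun k => by
    have h : IdentDistrib (fun ω => (U k ω, V k ω)) (fun ω => (U 0 ω, V 0 ω)) P P :=
      ⟨(hlaw k).aemeasurable, (hlaw 0).aemeasurable, (hlaw k).map_eq.trans (hlaw 0).map_eq.symm⟩
    exact h.comp hYm
  have hYc : ∀ m, Continuous fun p : UnitSphere d × UnitSphere d => stackedProduct p m := fun m =>
    (EuclideanSpace.proj m : EuclideanSpace ℝ (Fin (d * d)) →L[ℝ] ℝ).continuous.comp
      continuous_stackedProduct
  have hXindep : iIndepFun X P := hindep.comp (fun _ => stackedProduct) fun _ => hYm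
  have hXint : ∀ k, Integrable (X k) P := fun k => (hL2 k).integrable (by norm_num)
  have hcoord2 : ∀ k m, MemLp (fun ω => X k ω m) 2 P := fun k m =>
    (EuclideanSpace.proj m : EuclideanSpace ℝ (Fin (d * d)) →L[ℝ] ℝ).comp_memLp' (hL2 k)
  have hcoord : ∀ k m, Integrable (fun ω => X k ω m) P := fun k m =>
    (hcoord2 k m).integrable (by norm_num)
  have hE1 : ∀ k m, ∫ ω, X k ω m ∂P = stackColumns (ρ • Q) m := fun k m => by
    have h := (hlaw k).integral_comp (f := fun p => stackedProduct p m)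
      (hYc m).aestronglyMeasurable
    refine h.trans ?_
    simp only [stackedProduct_apply]
    rw [integral_const_mul, integral_coords_mul_coords_bsMeasure hd hρ0 hρ1 hQ]
    simp only [stackColumns, Matrix.smul_apply, smul_eq_mul]
    field_simp
  have hE2 : ∀ m n, ∫ ω, X 0 ω m * X 0 ω n ∂P =
      asymptoticCov ρ Q m n + stackColumns (ρ • Q) m * stackColumns (ρ • Q) n := fun m n => by
    have h := (hlaw 0).integral_comp (f := fun p => stackedProduct p m * stackedProduct p n)
      ((hYc m).mul (hYc n)).aestronglyMeasurable
    refine h.trans ?_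
    simp only [stackedProduct_apply, mul_mul_mul_comm (d : ℝ)]
    rw [integral_const_mul, integral_coords_mul_four_bsMeasure hd hρ0 hρ1 hQ, asymptoticCov_apply hd]
    simp only [stackColumns, Matrix.smul_apply, smul_eq_mul]
    ring
  have hmean : ∀ t, ∫ ω, ⟪X 0 ω, t⟫_ℝ ∂P = ⟪stackColumns (ρ • Q), t⟫_ℝ := fun t => by
    simp only [PiLp.inner_apply]
    rw [integral_finsetSum _ fun m _ => by simpa using (hcoord 0 m).const_mul (t m)]
    simp [integral_const_mul, hE1]
  have hvar : ∀ t : EuclideanSpace ℝ (Fin (d * d)),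
      Var[fun ω => ⟪X 0 ω, t⟫_ℝ; P] = t ⬝ᵥ (asymptoticCov ρ Q *ᵥ t) := fun t => by
    have hLt : MemLp (fun ω => ⟪X 0 ω, t⟫_ℝ) 2 P := by
      have := (innerSL ℝ t).comp_memLp' (hL2 0)
      simpa [Function.comp_def, real_inner_comm] using this
    have hprod : ∀ m n, Integrable (fun ω => X 0 ω m * X 0 ω n) P := fun m n =>
      (hcoord2 0 m).integrable_mul (hcoord2 0 n)
    have hsq : ∀ x y : EuclideanSpace ℝ (Fin (d * d)), ⟪x, t⟫_ℝ * ⟪y, t⟫_ℝ =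
        ∑ m, ∑ n, t m * t n * (x m * y n) := fun x y => by
      simp only [PiLp.inner_apply, Finset.sum_mul_sum, RCLike.inner_apply, RCLike.conj_to_real]
      exact Finset.sum_congr rfl fun m _ => Finset.sum_congr rfl fun n _ => by ring
    rw [variance_eq_sub hLt, hmean t]
    simp only [Pi.pow_apply, pow_two, hsq]
    rw [integral_finsetSum _ fun m _ => integrable_finsetSum _ fun n _ => (hprod m n).const_mul _]
    simp only [integral_finsetSum _ fun n _ => (hprod _ n).const_mul _, integral_const_mul, hE2,
      ← Finset.sum_sub_distrib, dotProduct, Matrix.mulVec, Finset.mul_sum]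
    exact Finset.sum_congr rfl fun m _ => Finset.sum_congr rfl fun n _ => by ring
  -- By `hvar`, the quadratic form at `x` is the variance of a projection.
  have hS : (asymptoticCov ρ Q).PosSemidef :=
    .of_dotProduct_mulVec_nonneg (asymptoticCov_isHermitian hd ρ Q) fun x => by
      have := hvar (WithLp.toLp 2 x)
      rw [star_trivial]
      exact (variance_nonneg _ _).trans_eq this
  refine ⟨fun n hn i k => ?_, ?_, hS, ?_⟩
  · have e : ∀ ω, momentEstimator U V n ω i k =
        (n : ℝ)⁻¹ * ∑ j ∈ Finset.range n, X j ω (finProdFinEquiv (k, i)) := fun ω => by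
      have := congrArg (fun x : EuclideanSpace ℝ (Fin (d * d)) => x (finProdFinEquiv (k, i)))
        (stackColumns_momentEstimator U V n ω)
      simpa only [stackColumns_finProdFinEquiv, PiLp.smul_apply, WithLp.ofLp_sum,
        Finset.sum_apply, smul_eq_mul] using this
    simp only [e]
    refine ⟨(integrable_finsetSum _ fun j _ => hcoord j _).const_mul _, ?_⟩
    rw [integral_const_mul, integral_finsetSum _ fun j _ => hcoord j _]
    simp only [hE1, Finset.sum_const, Finset.card_range, nsmul_eq_mul]
    have : (n : ℝ) ≠ 0 := by positivity
    rw [inv_mul_cancel_left₀ this, stackColumns_finProdFinEquiv]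
  · have hmeanX : ∫ ω, X 0 ω ∂P = stackColumns (ρ • Q) := by
      ext m
      rw [← hE1 0 m]
      exact ((EuclideanSpace.proj m : EuclideanSpace ℝ (Fin (d * d)) →L[ℝ] ℝ).integral_comp_comm
        (hXint 0)).symm
    simp only [stackColumns_momentEstimator]
    -- The vector-valued strong law gives almost sure convergence, which is stronger.
    refine tendstoInMeasure_of_tendsto_ae (fun n => ?_) ?_
    · exact ((Finset.aemeasurable_fun_sum _ fun k _ => hXm k).const_smul
        ((n : ℝ)⁻¹)).aestronglyMeasurable
    · rw [← hmeanX]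
      exact strong_law_ae X (hXint 0) (fun i j hij => hXindep.indepFun hij) hident
  · simp only [stackColumns_momentEstimator]
    exact tendstoInDistribution_multivariateGaussian hS (hL2 0) hmean hvar hXindep hident
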